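/- Let $X$ be a Polish topological abelian group, with Borel $\sigma$-algebra $\mathcal B(X)$ (for example a Polish linear space such as $\mathbb R^d$). Let $\mathfrak X=\bigsqcup_{n\in\{0,1,2,\dots,\infty\}}X^n$ carry the disjoint union topology and its Borel $\sigma$-algebra, and put $\mathcal Z=X\times\mathfrak X$. For $S=X$ or $S=\mathcal Z$ let $\Gamma_S^\sharp$ be the space of generalized configurations in $S$, i.e. of $\{0,1,2,\dots,\infty\}$-valued measures on $S$ concentrated on a countable set (equivalently, countable aggregates of points of $S$, where multiple and accumulation points are allowed), with the $\sigma$-algebra generated by the sets $\{\gamma:\gamma(B)=n\}$, $B\in\mathcal B(S)$, $n\in\{0,1,2,\dots\}$. Unions $\bigsqcup$ and the notation $x\in\gamma$ below count points with multiplicity. Let $\mathfrak p:\mathfrak X\to\Gamma_X^\sharp$, $\mathfrak p(y_1,y_2,\dots)=\bigsqcup_i\{y_i\}$. Let $\mu_{\rm c}$ be a probability measure on $\Gamma_X^\sharp$, let $\eta$ be a probability measure on $\mathfrak X$, and let $\mu_0=\eta\circ\mathfrak p^{-1}$. The cluster measure $\mu_{\rm cl}$ is the law on $\Gamma_X^\sharp$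 of $\bigsqcup_{x\in\gamma_{\rm c}}\gamma'_x$, where $\gamma_{\rm c}$ has law $\mu_{\rm c}$ and, given $\gamma_{\rm c}$, the clusters $\gamma'_x$ ($x\in\gamma_{\rm c}$) are independent, $\gamma'_x$ having the law $\mu_x(A)=\mu_0(A-x)$. The lifted measure $\hat\mu$ is the law on $\Gamma_{\mathcal Z}^\sharp$ of $\bigsqcup_{x\in\gamma_{\rm c}}\{(x,\bar y_x)\}$, where $\gamma_{\rm c}$ has law $\mu_{\rm c}$ and, given $\gamma_{\rm c}$, the vectors $\bar y_x$ ($x\in\gamma_{\rm c}$) are i.i.d. with law $\eta$. Let $\mathfrak q:\Gamma_{\mathcal Z}^\sharp\to\Gamma_X^\sharp$ be given by $$\mathfrak q(\hat\gamma)=\bigsqcup_{(x,\bar y)\in\hat\gamma}\mathfrak q(x,\bar y),\qquad \mathfrak q(x,\bar y)=\mathfrak p(\bar y+x)=\bigsqcup_{y_i\in\bar y}\{y_i+x\}.$$ Then $\hat\mu$ and $\mu_{\rm cl}$ are well-defined probability measures, the maps $\mathfrak p$ and $\mathfrak q$ are measurable, and the cluster measure is the push-forward of the lifted measure under $\mathfrak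 q$: $$\mu_{\rm cl}=\mathfrak q^{*}\hat\mu\equiv\hat\mu\circ\mathfrak q^{-1}.$$ -/

import Mathlib

open MeasureTheory Set
open scoped ENNReal

noncomputable section

namespace Cluster

/-- The space `𝔛 = ⨆ₙ Xⁿ` (disjoint union over `n ∈ {0, 1, 2, …, ∞}`) of finite and infinite
sequences in `X`; an element of `Xⁿ` is a family indexed by the natural numbers `i < n`.
It carries the disjoint union topology and σ-algebra. -/
abbrev Vec (X : Type*) : Type _ := Σ n : ℕ∞, ({i : ℕ // (i : ℕ∞) < n} → X)

instance instMeasurableSingletonClassVec {X : Type*} [MeasurableSpace X]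
    [MeasurableSingletonClass X] : MeasurableSingletonClass (Vec X) := by
  refine ⟨fun v => ?_⟩
  obtain ⟨n, y⟩ := v
  refine MeasurableSpace.measurableSet_iInf.2 fun m => ?_
  change MeasurableSet (Sigma.mk m ⁻¹' {(⟨n, y⟩ : Vec X)})
  by_cases h : m = n
  · subst h
    have : Sigma.mk m ⁻¹' {(⟨m, y⟩ : Vec X)} = {y} := by
      ext z
      simp
    rw [this]
    exact measurableSet_singleton y
  · have : Sigma.mk m ⁻¹' {(⟨n, y⟩ : Vec X)} = ∅ := by
      ext z
      simp [h]
    rw [this]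
    exact MeasurableSet.empty

/-- The disjoint union σ-algebra on `𝔛` is the Borel σ-algebra of the disjoint union topology. -/
instance instBorelSpaceVec {X : Type*} [TopologicalSpace X] [SecondCountableTopology X]
    [MeasurableSpace X] [BorelSpace X] : BorelSpace (Vec X) := by
  refine ⟨le_antisymm ?_ ?_⟩
  · intro s hs
    have hs' : ∀ n, MeasurableSet (Sigma.mk n ⁻¹' s) := MeasurableSpace.measurableSet_iInf.1 hs
    have hU : s = ⋃ n, Sigma.mk n '' (Sigma.mk n ⁻¹' s) := by
      ext ⟨n, y⟩
      simp only [mem_iUnion]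
      constructor
      · intro h
        exact ⟨n, y, h, rfl⟩
      · rintro ⟨m, z, hz, h⟩
        rw [← h]
        exact hz
    rw [hU]
    let _ : MeasurableSpace (Vec X) := borel _
    have : BorelSpace (Vec X) := ⟨rfl⟩
    exact MeasurableSet.iUnion fun n =>
      (Topology.IsOpenEmbedding.sigmaMk (σ := fun n : ℕ∞ => {i : ℕ // (i : ℕ∞) < n} → X)
        (i := n)).measurableEmbedding.measurableSet_image.2 (hs' n)
  · refine MeasurableSpace.generateFrom_le fun s hs => ?_
    exact MeasurableSpace.measurableSet_iInf.2 fun n =>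
      (hs.preimage continuous_sigmaMk).measurableSet

/-- Generalized configurations in `X` (the space `Γ_X^♯`): measures on `X` with values in
`{0, 1, 2, …, ∞}` that are concentrated on a countable set. Multiple and accumulation points
are allowed. -/
@[ext]
structure Config (X : Type*) [MeasurableSpace X] where
  /-- The counting measure `B ↦ γ(B)` of the configuration. -/
  toMeasure : Measure X
  enat_valued : ∀ B, MeasurableSet B → ∃ n : ℕ∞, toMeasure B = (n : ℝ≥0∞)
  exists_countable : ∃ S : Set X, S.Countable ∧ toMeasure Sᶜ = 0

/-- The cylinder σ-algebra on `Γ_X^♯`, generated by the sets `{γ | γ(B) = n}`. -/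
instance instMeasurableSpaceConfig {X : Type*} [MeasurableSpace X] : MeasurableSpace (Config X) :=
  MeasurableSpace.generateFrom
    {C | ∃ (B : Set X) (n : ℕ), MeasurableSet B ∧ C = {γ : Config X | γ.toMeasure B = (n : ℝ≥0∞)}}

section Operations

variable {X Y : Type*} [MeasurableSpace X] [MeasurableSpace Y]

/-- The one-point configuration `{x}`. -/
def Config.single [MeasurableSingletonClass X] (x : X) : Config X :=
  ⟨Measure.dirac x, by
    intro B hB
    by_cases hx : x ∈ B
    · exact ⟨1, by simp [Measure.dirac_apply' x hB, hx]⟩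
    · exact ⟨0, by simp [Measure.dirac_apply' x hB, hx]⟩, by
    exact ⟨{x}, countable_singleton x, by simp⟩⟩

/-- The disjoint union (with multiplicities) `⨆ᵢ γᵢ` of countably many configurations, that is,
the sum of the corresponding measures. -/
def Config.union {ι : Type*} [Countable ι] (c : ι → Config X) : Config X :=
  ⟨Measure.sum fun i => (c i).toMeasure, by
    intro B hB
    choose n hn using fun i => (c i).enat_valued B hB
    rw [Measure.sum_apply _ hB]
    simp_rw [hn]
    have hmem : (∑' i, (n i : ℝ≥0∞)) ∈ range ENat.toENNReal := by
      refine ENat.isClosedEmbedding_toENNReal.isClosed_range.mem_of_tendsto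
        (ENNReal.summable (f := fun i => (n i : ℝ≥0∞))).hasSum (Filter.Eventually.of_forall ?_)
      intro s
      exact ⟨∑ i ∈ s, n i, map_sum ENat.toENNRealRingHom _ _⟩
    obtain ⟨m, hm⟩ := hmem
    exact ⟨m, hm.symm⟩, by
    choose S hS h0 using fun i => (c i).exists_countable
    refine ⟨⋃ i, S i, countable_iUnion hS, ?_⟩
    rw [Measure.sum_apply_eq_zero]
    intro i
    exact measure_mono_null (compl_subset_compl.2 (subset_iUnion S i)) (h0 i)⟩

/-- The points of a configuration `γ`, repeated according to their multiplicities: the point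
`x` is represented by the pairs `(x, k)` with `k < γ({x})`. -/
abbrev Config.Pt (γ : Config X) : Type _ :=
  {p : X × ℕ // (p.2 : ℝ≥0∞) < γ.toMeasure {p.1}}

/-- The location in `X` of a point of `γ`. -/
abbrev Config.Pt.loc {γ : Config X} (p : γ.Pt) : X := p.1.1

instance instCountablePt (γ : Config X) : Countable γ.Pt := by
  obtain ⟨S, hS, h0⟩ := γ.exists_countable
  refine Set.Countable.to_subtype (s := {p : X × ℕ | (p.2 : ℝ≥0∞) < γ.toMeasure {p.1}})
    ((hS.prod countable_univ).mono ?_)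
  rintro ⟨x, k⟩ hp
  refine ⟨by_contra fun hx => ?_, mem_univ _⟩
  have hz : γ.toMeasure {x} = 0 := measure_mono_null (singleton_subset_iff.2 hx) h0
  rw [mem_ofPred_eq, hz] at hp
  exact not_lt_zero hp

/-- Pointwise lifting of a map `f : X → Γ_Y^♯` to configurations: `γ ↦ ⨆_{x ∈ γ} f(x)`, where
the points of `γ` are taken with their multiplicities. -/
def Config.lift (f : X → Config Y) (γ : Config X) : Config Y :=
  Config.union fun p : γ.Pt => f p.loc

/-- The unpacking map `𝔭 : 𝔛 → Γ_X^♯`, `𝔭(x₁, x₂, …) = ⨆ᵢ {xᵢ}`. -/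
def unpack [MeasurableSingletonClass X] (v : Vec X) : Config X :=
  Config.union fun i => Config.single (v.2 i)

/-- Attaching marks to the points of `γ`: `γ ↦ ⨆_{x ∈ γ} {(x, ȳ_x)}`. -/
def attach [MeasurableSingletonClass X] [MeasurableSingletonClass Y] (γ : Config X)
    (y : γ.Pt → Y) : Config (X × Y) :=
  Config.union fun p => Config.single (p.loc, y p)

end Operations

section Lifted

variable {X : Type*} [MeasurableSpace X] [MeasurableSingletonClass X]

/-- The conditional law of `γ̂ = ⨆_{x ∈ γ} {(x, ȳ_x)}` given the centres `γ`: the vectors `ȳ_x`,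
`x ∈ γ`, are independent with common distribution `η`. -/
def liftedLaw (η : Measure (Vec X)) (γ : Config X) : Measure (Config (X × Vec X)) :=
  (Measure.infinitePi fun _ : γ.Pt => η).map (attach γ)

/-- The lifted measure `μ̂` on `Γ_𝒵^♯`, `𝒵 = X × 𝔛`, that is, `μ̂(A) = ∫ liftedLaw η γ A dμ_c(γ)`. -/
def liftedMeasure (μc : Measure (Config X)) (η : Measure (Vec X)) :
    Measure (Config (X × Vec X)) :=
  μc.bind (liftedLaw η)

end Lifted

section Shift

variable {X : Type*} [Add X]

/-- The shift `ȳ + x = (y₁ + x, y₂ + x, …)`. -/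
def Vec.shift (v : Vec X) (x : X) : Vec X := ⟨v.1, fun i => v.2 i + x⟩

variable [MeasurableSpace X] [MeasurableSingletonClass X]

/-- The translate `γ + x` of a configuration. -/
def Config.translate (x : X) (γ : Config X) : Config X :=
  Config.lift (fun y => Config.single (y + x)) γ

/-- The conditional law of a cluster configuration `⨆_{x ∈ γ} γ'_x` given the centres `γ`: the
clusters `γ'_x`, `x ∈ γ`, are independent and `γ'_x` has the law `μ_x(A) = μ₀(A - x)`. -/
def clusterLaw (μ₀ : Measure (Config X)) (γ : Config X) : Measure (Config X) :=
  (Measure.infinitePi fun p : γ.Pt => μ₀.map (Config.translate p.loc)).map Config.union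

/-- The law `μ_cl` of the i.i.d. cluster point process with law of centres `μ_c` and law `μ₀` of
the cluster centred at `0`, that is, `μ_cl(A) = ∫ clusterLaw μ₀ γ A dμ_c(γ)`. -/
def clusterMeasure (μc μ₀ : Measure (Config X)) : Measure (Config X) :=
  μc.bind (clusterLaw μ₀)

/-- The map `𝔮 : 𝒵 → Γ_X^♯`, `𝔮(x, ȳ) = 𝔭(ȳ + x) = ⨆ᵢ {yᵢ + x}`. -/
def qPoint (z : X × Vec X) : Config X := unpack (Vec.shift z.2 z.1)

/-- The map `𝔮 : Γ_𝒵^♯ → Γ_X^♯`, `𝔮(γ̂) = ⨆_{z ∈ γ̂} 𝔮(z)`. -/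
def qMap : Config (X × Vec X) → Config X := Config.lift qPoint

end Shift

end Cluster

end

/-! Conditionally on the centres the identity is coordinatewise: `translate_unpack` says that
shifting an unpacked cluster by `x` gives `qPoint (x, v)`, so the independent clusters are images of
independent marks, and `clusterLaw μ₀ γ` is the image of `liftedLaw η γ` under `qMap`. Integrating
over `μc` gives the theorem.

The integration needs `γ ↦ liftedLaw η γ` to be measurable, although the product space is indexed by
`γ.Pt`, which varies with `γ`. Laplace functionals avoid choosing a measurable enumeration of the
points: by independence, the integral of `exp (-∫ f)` under `liftedLaw η γ` is `exp (-∫ g dγ)` with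
`g x = -log ∫ exp (-f (x, y)) dη(y)`, visibly measurable in `γ`. These functionals are closed under
products, so their span is an algebra; it generates the cylinder σ-algebra and therefore determines
measurability of the kernel. -/

namespace Cluster

/-! ### Kernel measurability from an algebra of functions; Laplace transforms of independent sums -/

section Abstract

open Filter Topology

variable {Ω α : Type*} [MeasurableSpace Ω] [MeasurableSpace α]

/-- If the integrals of all functions of an algebra of bounded measurable functions depend
measurably on a parameter, then so do the probabilities of the sets in any σ-algebra generated by
sets `{h = 1}`, where `h` belongs to the algebra and takes values in `[0, 1]`. -/
theorem measurable_of_measurable_integral_subalgebra {κ : α → Measure Ω}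
    [∀ a, IsProbabilityMeasure (κ a)] (𝒜 : Subalgebra ℝ (Ω → ℝ))
    (h_meas : ∀ h ∈ 𝒜, Measurable h)
    (h_int : ∀ h ∈ 𝒜, Measurable fun a => ∫ ω, h ω ∂κ a)
    (h_gen : ‹MeasurableSpace Ω› ≤ MeasurableSpace.generateFrom
      {A | ∃ h ∈ 𝒜, (∀ ω, 0 ≤ h ω ∧ h ω ≤ 1) ∧ A = {ω | h ω = 1}}) :
    Measurable κ := by
  have h_set : ∀ A ∈ {A | ∃ h ∈ 𝒜, (∀ ω, 0 ≤ h ω ∧ h ω ≤ 1) ∧ A = {ω | h ω = 1}},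
      MeasurableSet A := by
    rintro _ ⟨h, hh, -, rfl⟩
    exact h_meas h hh (measurableSet_singleton 1)
  refine Measurable.measure_of_isPiSystem_of_isProbabilityMeasure
    (le_antisymm h_gen (MeasurableSpace.generateFrom_le h_set)) ?_ ?_
  -- For values in `[0, 1]`, a product is 1 exactly when both factors are.
  · rintro _ ⟨g, hg, hg1, rfl⟩ _ ⟨h, hh, hh1, rfl⟩ -
    refine ⟨g * h, 𝒜.mul_mem hg hh, fun ω => ⟨mul_nonneg (hg1 ω).1 (hh1 ω).1,
      mul_le_one₀ (hg1 ω).2 (hh1 ω).1 (hh1 ω).2⟩, ?_⟩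
    ext ω
    have := hg1 ω
    have := hh1 ω
    simp only [mem_inter_iff, mem_ofPred_eq, Pi.mul_apply]
    constructor
    · rintro ⟨h1, h2⟩
      rw [h1, h2, one_mul]
    · intro h1
      constructor <;> nlinarith
  · rintro A ⟨h, hh, hh1, rfl⟩
    have hA := h_set _ ⟨h, hh, hh1, rfl⟩
    -- The powers `h ^ k` stay in the algebra and converge to the indicator of `{h = 1}`.
    have h_lim : ∀ a, Tendsto (fun k : ℕ => ∫ ω, (h ^ k) ω ∂κ a) atTop
        (𝓝 ((κ a).real {ω | h ω = 1})) := by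
      intro a
      rw [← integral_indicator_one hA]
      refine tendsto_integral_of_dominated_convergence (fun _ => 1)
        (fun k => (h_meas _ (𝒜.pow_mem hh k)).aestronglyMeasurable) (integrable_const 1) ?_ ?_
      · refine fun k => ae_of_all _ fun ω => ?_
        rw [Pi.pow_apply, Real.norm_of_nonneg (pow_nonneg (hh1 ω).1 k)]
        exact pow_le_one₀ (hh1 ω).1 (hh1 ω).2
      · refine ae_of_all _ fun ω => ?_
        by_cases hω : h ω = 1
        · simp [hω]
        · simpa [indicator, hω] using
            tendsto_pow_atTop_nhds_zero_of_lt_one (hh1 ω).1 (lt_of_le_of_ne (hh1 ω).2 hω)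
    have h_real : Measurable fun a => (κ a).real {ω | h ω = 1} :=
      measurable_of_tendsto_metrizable (fun k => h_int _ (𝒜.pow_mem hh k)) (tendsto_pi_nhds.2 h_lim)
    simpa [measureReal_def] using h_real.ennreal_ofReal

/-- `x ↦ e^{-x}` on `[0, ∞]`. -/
noncomputable def expNeg (x : ℝ≥0∞) : ℝ≥0∞ := EReal.exp (-(x : EReal))

theorem continuous_expNeg : Continuous expNeg :=
  ENNReal.continuous_exp.comp (continuous_neg.comp continuous_coe_ennreal_ereal)

theorem expNeg_le_one (x : ℝ≥0∞) : expNeg x ≤ 1 := by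
  simp [expNeg, EReal.coe_ennreal_nonneg]

theorem expNeg_ne_top (x : ℝ≥0∞) : expNeg x ≠ ∞ :=
  ((expNeg_le_one x).trans_lt ENNReal.one_lt_top).ne

@[simp]
theorem expNeg_zero : expNeg 0 = 1 := by
  simp [expNeg]

theorem expNeg_add (x y : ℝ≥0∞) : expNeg (x + y) = expNeg x * expNeg y := by
  rw [expNeg, expNeg, expNeg, ← EReal.exp_add, EReal.coe_ennreal_add, EReal.neg_add, sub_eq_add_neg]
  · exact Or.inl (EReal.coe_ennreal_ne_bot x)
  · exact Or.inr (EReal.coe_ennreal_ne_bot y)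

theorem expNeg_injective : Function.Injective expNeg := fun x y h => by
  simpa using EReal.exp_strictMono.injective h

theorem expNeg_finset_sum {ι : Type*} (s : Finset ι) (x : ι → ℝ≥0∞) :
    expNeg (∑ i ∈ s, x i) = ∏ i ∈ s, expNeg (x i) := by
  classical
  induction s using Finset.induction_on with
  | empty => simp
  | insert i s hi ih => rw [Finset.sum_insert hi, Finset.prod_insert hi, expNeg_add, ih]

theorem tendsto_prod_expNeg {ι : Type*} (x : ι → ℝ≥0∞) :
    Tendsto (fun s : Finset ι => ∏ i ∈ s, expNeg (x i)) atTop (𝓝 (expNeg (∑' i, x i))) := by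
  simp_rw [← expNeg_finset_sum]
  exact (continuous_expNeg.tendsto _).comp ENNReal.summable.hasSum

/-- `t ↦ -log t` on `[0, 1]`, the inverse of `expNeg`. -/
noncomputable def negLog (t : ℝ≥0∞) : ℝ≥0∞ := (-ENNReal.log t).toENNReal

theorem measurable_negLog : Measurable negLog :=
  measurable_ereal_toENNReal.comp (continuous_neg.measurable.comp ENNReal.measurable_log)

theorem expNeg_negLog {t : ℝ≥0∞} (ht : t ≤ 1) : expNeg (negLog t) = t := by
  rw [expNeg, negLog, EReal.coe_toENNReal, neg_neg, ENNReal.exp_log]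
  simpa [EReal.le_neg] using ht

/-- The Laplace transform of a countable sum of functions of independent variables. -/
theorem lintegral_expNeg_tsum_infinitePi {ι : Type*} [Countable ι] {Y : ι → Type*}
    [∀ i, MeasurableSpace (Y i)] (ν : ∀ i, Measure (Y i)) [∀ i, IsProbabilityMeasure (ν i)]
    {f : ∀ i, Y i → ℝ≥0∞} (hf : ∀ i, Measurable (f i)) :
    ∫⁻ y, expNeg (∑' i, f i (y i)) ∂Measure.infinitePi ν =
      expNeg (∑' i, negLog (∫⁻ y, expNeg (f i y) ∂ν i)) := by
  have hm : ∀ i, Measurable fun y => expNeg (f i y) :=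
    fun i => continuous_expNeg.measurable.comp (hf i)
  -- Dominated convergence along finite subsets; countability of `ι` makes this filter countably
  -- generated.
  have h1 : Tendsto (fun s : Finset ι => ∫⁻ y, ∏ i ∈ s, expNeg (f i (y i)) ∂Measure.infinitePi ν)
      atTop (𝓝 (∫⁻ y, expNeg (∑' i, f i (y i)) ∂Measure.infinitePi ν)) := by
    refine tendsto_lintegral_filter_of_dominated_convergence (fun _ => 1)
      (Eventually.of_forall fun s => ?_) (Eventually.of_forall fun s => ae_of_all _ fun y => ?_)
      (by simp) (ae_of_all _ fun y => tendsto_prod_expNeg _)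
    · exact Finset.measurable_prod _ fun i _ => (hm i).comp (measurable_pi_apply i)
    · exact Finset.prod_le_one' fun i _ => expNeg_le_one _
  have h2 : ∀ s : Finset ι, ∫⁻ y, ∏ i ∈ s, expNeg (f i (y i)) ∂Measure.infinitePi ν =
      ∏ i ∈ s, expNeg (negLog (∫⁻ y, expNeg (f i y) ∂ν i)) := by
    intro s
    have h3 : ∀ i, ∫⁻ y, expNeg (f i y) ∂ν i ≤ 1 := fun i =>
      (lintegral_mono fun y => expNeg_le_one _).trans (by simp)
    simp_rw [fun i => expNeg_negLog (h3 i)]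
    refine (ProbabilityTheory.lintegral_prod_eq_prod_lintegral_of_indepFun
      (μ := Measure.infinitePi ν) s (fun i (y : ∀ i, Y i) => expNeg (f i (y i)))
      (ProbabilityTheory.iIndepFun_infinitePi hm)
      fun i => (hm i).comp (measurable_pi_apply i)).trans ?_
    exact Finset.prod_congr rfl fun i _ =>
      (measurePreserving_eval_infinitePi ν i).lintegral_comp (hm i)
  exact tendsto_nhds_unique (by simpa only [h2] using h1) (tendsto_prod_expNeg _)

end Abstract

/-- Counts the pairs `(x, k)` that represent a point of multiplicity `n` in `Config.Pt`. -/
theorem tsum_indicator_lt_enat (n : ℕ∞) :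
    ∑' k : ℕ, (if (k : ℝ≥0∞) < (n : ℝ≥0∞) then (1 : ℝ≥0∞) else 0) = n := by
  induction n using ENat.recTopCoe with
  | top => simp
  | coe n =>
    rw [tsum_eq_sum (s := Finset.range n) fun k hk => ?_]
    · rw [Finset.sum_congr rfl fun k hk => if_pos ?_]
      · simp
      · simpa using hk
    · simpa using hk

/-! ### Measurability of the operations on configurations -/

namespace Config

section Measurability

variable {X Y α : Type*} [MeasurableSpace X] [MeasurableSpace Y] [MeasurableSpace α]

theorem ext_of_apply {γ γ' : Config X}
    (h : ∀ B, MeasurableSet B → γ.toMeasure B = γ'.toMeasure B) : γ = γ' :=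
  Config.ext (Measure.ext h)

theorem measurable_apply {B : Set X} (hB : MeasurableSet B) :
    Measurable fun γ : Config X => γ.toMeasure B := by
  have h_nat : ∀ n : ℕ, MeasurableSet {γ : Config X | γ.toMeasure B = (n : ℝ≥0∞)} :=
    fun n => MeasurableSpace.measurableSet_generateFrom ⟨B, n, hB, rfl⟩
  -- The generators involve finite counts only; the value `∞` is what remains.
  have h_top : MeasurableSet {γ : Config X | γ.toMeasure B = ∞} := by
    convert (MeasurableSet.iUnion h_nat).compl using 1
    ext γ
    obtain ⟨n, hn⟩ := γ.enat_valued B hB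
    induction n using ENat.recTopCoe with
    | top => simp [hn]
    | coe n => simp [hn]
  intro s _
  have h_union : (fun γ : Config X => γ.toMeasure B) ⁻¹' s =
      (⋃ n : ℕ, {γ | γ.toMeasure B = (n : ℝ≥0∞) ∧ (n : ℝ≥0∞) ∈ s}) ∪
        {γ | γ.toMeasure B = ∞ ∧ ∞ ∈ s} := by
    ext γ
    obtain ⟨n, hn⟩ := γ.enat_valued B hB
    induction n using ENat.recTopCoe with
    | top => simp [hn]
    | coe n => simp [hn]
  rw [h_union]
  exact (MeasurableSet.iUnion fun n => (h_nat n).inter (MeasurableSet.const _)).union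
    (h_top.inter (MeasurableSet.const _))

theorem measurable_of_apply {f : α → Config X}
    (h : ∀ B, MeasurableSet B → Measurable fun a => (f a).toMeasure B) : Measurable f := by
  refine measurable_generateFrom ?_
  rintro _ ⟨B, n, hB, rfl⟩
  exact h B hB (measurableSet_singleton _)

theorem measurable_toMeasure : Measurable (Config.toMeasure (X := X)) :=
  Measure.measurable_of_measurable_coe _ fun _ hB => measurable_apply hB

theorem union_apply {ι : Type*} [Countable ι] (c : ι → Config X) {B : Set X}
    (hB : MeasurableSet B) : (union c).toMeasure B = ∑' i, (c i).toMeasure B :=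
  Measure.sum_apply _ hB

theorem measurable_union {ι : Type*} [Countable ι] :
    Measurable (union : (ι → Config X) → Config X) := by
  refine measurable_of_apply fun B hB => ?_
  simp_rw [union_apply _ hB]
  exact Measurable.tsum fun i => (measurable_apply hB).comp (measurable_pi_apply i)

variable [MeasurableSingletonClass X]

theorem measurable_single : Measurable (single : X → Config X) := by
  refine measurable_of_apply fun B hB => ?_
  exact (Measure.measurable_coe hB).comp Measure.measurable_dirac

/-- A configuration is the sum of the unit masses at its points. -/
theorem toMeasure_eq_sum_dirac (γ : Config X) :
    γ.toMeasure = Measure.sum fun p : γ.Pt => Measure.dirac p.loc := by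
  ext B hB
  obtain ⟨S, hS, h0⟩ := γ.exists_countable
  have h_lhs : γ.toMeasure B = ∑' x : ↥(B ∩ S), γ.toMeasure {x.1} := by
    rw [← measure_biUnion (hS.mono inter_subset_right)
      (fun x _ y _ hxy => disjoint_singleton.2 hxy) fun x _ => measurableSet_singleton x,
      biUnion_of_singleton]
    exact (measure_inter_conull h0).symm
  have h_pt : ∀ x k, indicator {p : X × ℕ | (p.2 : ℝ≥0∞) < γ.toMeasure {p.1}}
      (fun p => Measure.dirac p.1 B) (x, k) =
      indicator B 1 x * if (k : ℝ≥0∞) < γ.toMeasure {x} then 1 else 0 := by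
    intro x k
    simp [indicator, Measure.dirac_apply' x hB]
  have h_rhs : ∑' p : γ.Pt, Measure.dirac p.loc B =
      ∑' x, indicator B 1 x * γ.toMeasure {x} := by
    refine (tsum_subtype {p : X × ℕ | (p.2 : ℝ≥0∞) < γ.toMeasure {p.1}}
      fun p => Measure.dirac p.1 B).trans ?_
    rw [ENNReal.tsum_prod']
    refine tsum_congr fun x => ?_
    simp_rw [h_pt]
    rw [ENNReal.tsum_mul_left]
    obtain ⟨n, hn⟩ := γ.enat_valued {x} (measurableSet_singleton x)
    rw [hn, tsum_indicator_lt_enat]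
  rw [Measure.sum_apply _ hB, h_lhs, h_rhs, tsum_subtype (B ∩ S) fun x => γ.toMeasure {x}]
  refine tsum_congr fun x => ?_
  by_cases hx : x ∈ B
  · by_cases hxS : x ∈ S
    · simp [hx, hxS]
    · simp [hx, hxS, measure_mono_null (singleton_subset_iff.2 hxS) h0]
  · simp [hx]

theorem lintegral_toMeasure (γ : Config X) {f : X → ℝ≥0∞} (hf : Measurable f) :
    ∫⁻ x, f x ∂γ.toMeasure = ∑' p : γ.Pt, f p.loc := by
  conv_lhs => rw [toMeasure_eq_sum_dirac γ]
  simp_rw [lintegral_sum_measure, lintegral_dirac' _ hf]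

/-- The integral form no longer mentions `γ.Pt`, so measurability in `γ` becomes accessible. -/
theorem lift_apply {f : X → Config Y} (hf : Measurable f) (γ : Config X) {B : Set Y}
    (hB : MeasurableSet B) :
    (lift f γ).toMeasure B = ∫⁻ x, (f x).toMeasure B ∂γ.toMeasure := by
  have h : Measurable fun x => (f x).toMeasure B := (measurable_apply hB).comp hf
  rw [lintegral_toMeasure γ h, lift, union_apply _ hB]

theorem measurable_lift {f : X → Config Y} (hf : Measurable f) : Measurable (lift f) := by
  refine measurable_of_apply fun B hB => ?_
  simp_rw [lift_apply hf _ hB]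
  exact (Measure.measurable_lintegral ((measurable_apply hB).comp hf)).comp measurable_toMeasure

theorem lintegral_union_single {ι : Type*} [Countable ι] (x : ι → X) {f : X → ℝ≥0∞}
    (hf : Measurable f) :
    ∫⁻ y, f y ∂(union fun i => single (x i)).toMeasure = ∑' i, f (x i) := by
  simp_rw [union, single, lintegral_sum_measure, lintegral_dirac' _ hf]

/-- The left side is indexed by the `Pt` of the union, the right by `ι`. Comparing integrals makes a
bijection between the two unnecessary. -/
theorem lift_union_single {ι : Type*} [Countable ι] {f : X → Config Y} (hf : Measurable f)
    (x : ι → X) : lift f (union fun i => single (x i)) = union fun i => f (x i) := by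
  refine ext_of_apply fun B hB => ?_
  have h : Measurable fun x => (f x).toMeasure B := (measurable_apply hB).comp hf
  rw [lift_apply hf _ hB, lintegral_union_single x h, union_apply _ hB]

end Measurability

end Config

/-! ### Laplace functionals and measurability of the marking kernel -/

section Attach

variable {X Y : Type*} [MeasurableSpace X]

theorem measurable_expNeg_lintegral {f : X → ℝ≥0∞} (hf : Measurable f) :
    Measurable fun γ : Config X => expNeg (∫⁻ x, f x ∂γ.toMeasure) :=
  continuous_expNeg.measurable.comp
    ((Measure.measurable_lintegral hf).comp Config.measurable_toMeasure)

/-- The functions `γ ↦ exp (-∫ f dγ)`, with `f` measurable and nonnegative. -/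
def laplaceSubmonoid (X : Type*) [MeasurableSpace X] : Submonoid (Config X → ℝ) where
  carrier := {h | ∃ f : X → ℝ≥0∞, Measurable f ∧
    h = fun γ => (expNeg (∫⁻ x, f x ∂γ.toMeasure)).toReal}
  one_mem' := ⟨0, measurable_const, by ext γ; simp⟩
  mul_mem' := by
    rintro _ _ ⟨f, hf, rfl⟩ ⟨g, hg, rfl⟩
    refine ⟨f + g, hf.add hg, ?_⟩
    ext γ
    simp [lintegral_add_left hf, expNeg_add]

theorem laplaceSubmonoid.measurable {h : Config X → ℝ} (hh : h ∈ laplaceSubmonoid X) :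
    Measurable h := by
  obtain ⟨f, hf, rfl⟩ := hh
  exact (measurable_expNeg_lintegral hf).ennreal_toReal

theorem laplaceSubmonoid.mem_Icc {h : Config X → ℝ} (hh : h ∈ laplaceSubmonoid X)
    (γ : Config X) : h γ ∈ Icc 0 1 := by
  obtain ⟨f, hf, rfl⟩ := hh
  exact ⟨ENNReal.toReal_nonneg, ENNReal.toReal_le_of_le_ofReal zero_le_one
    (by simpa using expNeg_le_one _)⟩

/-- The algebra spanned by the Laplace functionals generates the cylinder σ-algebra. -/
theorem le_generateFrom_adjoin_laplaceSubmonoid :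
    instMeasurableSpaceConfig (X := X) ≤ MeasurableSpace.generateFrom
      {A | ∃ h ∈ Algebra.adjoin ℝ (laplaceSubmonoid X : Set (Config X → ℝ)),
        (∀ γ, 0 ≤ h γ ∧ h γ ≤ 1) ∧ A = {γ | h γ = 1}} := by
  refine MeasurableSpace.generateFrom_mono ?_
  rintro _ ⟨B, n, hB, rfl⟩
  let g : Config X → ℝ := fun γ => (expNeg (γ.toMeasure B)).toReal
  have hg : g ∈ laplaceSubmonoid X :=
    ⟨indicator B 1, measurable_one.indicator hB, by simp [g, lintegral_indicator_one hB]⟩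
  let c : ℝ := (expNeg n).toReal
  have hc : c ∈ Icc (0 : ℝ) 1 := ⟨ENNReal.toReal_nonneg,
    ENNReal.toReal_le_of_le_ofReal zero_le_one (by simpa using expNeg_le_one _)⟩
  -- As `g` and `c` lie in `[0, 1]`, so does this function; it is 1 exactly when `g = c`, that is,
  -- when `γ(B) = n`.
  refine ⟨1 - (g - algebraMap ℝ _ c) ^ 2, ?_, fun γ => ?_, ?_⟩
  · exact Subalgebra.sub_mem _ (Subalgebra.one_mem _) (Subalgebra.pow_mem _ (Subalgebra.sub_mem _
      (Algebra.subset_adjoin hg) (Subalgebra.algebraMap_mem _ c)) 2)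
  · have hgγ := laplaceSubmonoid.mem_Icc hg γ
    simp only [Pi.sub_apply, Pi.one_apply, Pi.pow_apply, Pi.algebraMap_apply,
      Algebra.algebraMap_self, RingHom.id_apply]
    obtain ⟨h1, h2⟩ := hgγ
    obtain ⟨h3, h4⟩ := hc
    constructor <;> nlinarith
  · ext γ
    simp only [mem_ofPred_eq, Pi.sub_apply, Pi.one_apply, Pi.pow_apply, Pi.algebraMap_apply,
      Algebra.algebraMap_self, RingHom.id_apply, sub_eq_self, ne_eq, OfNat.ofNat_ne_zero,
      not_false_eq_true, pow_eq_zero_iff, sub_eq_zero, g, c]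
    rw [ENNReal.toReal_eq_toReal_iff' (expNeg_ne_top _) (expNeg_ne_top _),
      expNeg_injective.eq_iff]

variable [MeasurableSpace Y] [MeasurableSingletonClass X] [MeasurableSingletonClass Y]

theorem measurable_attach (γ : Config X) : Measurable (attach (Y := Y) γ) := by
  refine Config.measurable_union.comp (measurable_pi_lambda _ fun p => ?_)
  exact Config.measurable_single.comp (measurable_const.prodMk (measurable_pi_apply p))

theorem lintegral_expNeg_map_attach (η : Measure Y) [IsProbabilityMeasure η] (γ : Config X)
    {f : X × Y → ℝ≥0∞} (hf : Measurable f) :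
    ∫⁻ γ', expNeg (∫⁻ z, f z ∂γ'.toMeasure)
        ∂(Measure.infinitePi fun _ : γ.Pt => η).map (attach γ) =
      expNeg (∫⁻ x, negLog (∫⁻ y, expNeg (f (x, y)) ∂η) ∂γ.toMeasure) := by
  have h_exp : Measurable fun z => expNeg (f z) := continuous_expNeg.measurable.comp hf
  have h_log : Measurable fun x => negLog (∫⁻ y, expNeg (f (x, y)) ∂η) :=
    measurable_negLog.comp h_exp.lintegral_prod_right'
  rw [lintegral_map (measurable_expNeg_lintegral hf) (measurable_attach γ),
    Config.lintegral_toMeasure γ h_log]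
  simp_rw [attach, Config.lintegral_union_single _ hf]
  exact lintegral_expNeg_tsum_infinitePi (fun _ : γ.Pt => η)
    fun p => hf.comp measurable_prodMk_left

/-- The law of an independent marking of a configuration depends measurably on the
configuration. -/
theorem measurable_map_attach (η : Measure Y) [IsProbabilityMeasure η] :
    Measurable fun γ : Config X => (Measure.infinitePi fun _ : γ.Pt => η).map (attach γ) := by
  have h_prob : ∀ γ : Config X,
      IsProbabilityMeasure ((Measure.infinitePi fun _ : γ.Pt => η).map (attach γ)) :=
    fun γ => Measure.isProbabilityMeasure_map (measurable_attach γ).aemeasurable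
  have h_alg : ∀ h ∈ Algebra.adjoin ℝ (laplaceSubmonoid (X × Y) : Set (Config (X × Y) → ℝ)),
      Measurable h ∧ (∃ C, ∀ γ, ‖h γ‖ ≤ C) ∧ Measurable fun γ : Config X =>
        ∫ γ', h γ' ∂(Measure.infinitePi fun _ : γ.Pt => η).map (attach γ) := by
    intro h hh
    -- The generators form a submonoid, so the algebra is their linear span and no product case
    -- arises. The bound is carried along for integrability in sums.
    rw [← Subalgebra.mem_toSubmodule, Algebra.adjoin_eq_span, Submonoid.closure_eq] at hh
    induction hh using Submodule.span_induction with
    | mem h hh =>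
      refine ⟨laplaceSubmonoid.measurable hh, ⟨1, fun γ => ?_⟩, ?_⟩
      · have := laplaceSubmonoid.mem_Icc hh γ
        rw [Real.norm_of_nonneg this.1]
        exact this.2
      · obtain ⟨f, hf, rfl⟩ := hh
        have h_exp : Measurable fun z => expNeg (f z) := continuous_expNeg.measurable.comp hf
        have h_int : ∀ γ : Config X, ∫ γ', (expNeg (∫⁻ z, f z ∂γ'.toMeasure)).toReal
              ∂(Measure.infinitePi fun _ : γ.Pt => η).map (attach γ) =
            (expNeg (∫⁻ x, negLog (∫⁻ y, expNeg (f (x, y)) ∂η) ∂γ.toMeasure)).toReal := by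
          intro γ
          rw [integral_toReal, lintegral_expNeg_map_attach η γ hf]
          · exact (measurable_expNeg_lintegral hf).aemeasurable
          · exact ae_of_all _ fun γ' => (expNeg_ne_top _).lt_top
        simp_rw [h_int]
        exact (measurable_expNeg_lintegral
          (measurable_negLog.comp h_exp.lintegral_prod_right')).ennreal_toReal
    | zero => exact ⟨measurable_const, ⟨0, by simp⟩, by simp⟩
    | add g h _ _ hg hh =>
      obtain ⟨hgm, ⟨C, hC⟩, hgi⟩ := hg
      obtain ⟨hhm, ⟨D, hD⟩, hhi⟩ := hh
      refine ⟨hgm.add hhm, ⟨C + D, fun γ => (norm_add_le _ _).trans (add_le_add (hC γ) (hD γ))⟩,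
        ?_⟩
      have h_add : ∀ γ : Config X,
          ∫ γ', (g + h) γ' ∂(Measure.infinitePi fun _ : γ.Pt => η).map (attach γ) =
          ∫ γ', g γ' ∂(Measure.infinitePi fun _ : γ.Pt => η).map (attach γ) +
          ∫ γ', h γ' ∂(Measure.infinitePi fun _ : γ.Pt => η).map (attach γ) := fun γ =>
        integral_add (Integrable.of_bound hgm.aestronglyMeasurable C (ae_of_all _ hC))
          (Integrable.of_bound hhm.aestronglyMeasurable D (ae_of_all _ hD))
      simp_rw [h_add]
      exact hgi.add hhi
    | smul c h _ hh =>
      obtain ⟨hhm, ⟨D, hD⟩, hhi⟩ := hh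
      refine ⟨hhm.const_smul c, ⟨‖c‖ * D, fun γ => ?_⟩, ?_⟩
      · rw [Pi.smul_apply, norm_smul]
        exact mul_le_mul_of_nonneg_left (hD γ) (norm_nonneg c)
      · simp_rw [Pi.smul_apply, integral_smul]
        exact hhi.const_smul c
  exact measurable_of_measurable_integral_subalgebra _ (fun h hh => (h_alg h hh).1)
    (fun h hh => (h_alg h hh).2.2) le_generateFrom_adjoin_laplaceSubmonoid

end Attach

/-! ### The maps `unpack` and `qMap`, and the conditional identity -/

section Vectors

theorem measurableEmbedding_sigmaMk {ι : Type*} {π : ι → Type*} [∀ i, MeasurableSpace (π i)]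
    (i : ι) : MeasurableEmbedding (Sigma.mk i : π i → Σ i, π i) where
  injective := sigma_mk_injective
  measurable := fun _ hs => MeasurableSpace.measurableSet_iInf.1 hs i
  measurableSet_image' := fun s hs => by
    refine MeasurableSpace.measurableSet_iInf.2 fun j => ?_
    change MeasurableSet (Sigma.mk j ⁻¹' (Sigma.mk i '' s))
    by_cases h : j = i
    · subst h
      rwa [preimage_image_eq _ sigma_mk_injective]
    · rw [preimage_image_sigmaMk_of_ne h]
      exact MeasurableSet.empty

variable {X : Type*} [MeasurableSpace X]

/-- `Y × Vec X` is a countable union of measurably embedded pieces, one for each length in `ℕ∞`. -/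
theorem measurable_prod_vec {Y Z : Type*} [MeasurableSpace Y] [MeasurableSpace Z]
    {F : Y × Vec X → Z}
    (hF : ∀ n : ℕ∞, Measurable fun z : Y × ({i : ℕ // (i : ℕ∞) < n} → X) => F (z.1, ⟨n, z.2⟩)) :
    Measurable F := by
  intro s hs
  have h_union : F ⁻¹' s = ⋃ n : ℕ∞, Prod.map id (Sigma.mk n) ''
      ((fun z : Y × ({i : ℕ // (i : ℕ∞) < n} → X) => F (z.1, ⟨n, z.2⟩)) ⁻¹' s) := by
    ext ⟨y, n, v⟩
    simp only [mem_preimage, mem_iUnion, mem_image]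
    constructor
    · exact fun h => ⟨n, (y, v), h, rfl⟩
    · rintro ⟨m, ⟨y', v'⟩, h, h_eq⟩
      rw [← h_eq]
      exact h
  rw [h_union]
  exact MeasurableSet.iUnion fun n =>
    (MeasurableEmbedding.id.prodMap (measurableEmbedding_sigmaMk n)).measurableSet_image.2
      (hF n hs)

theorem measurable_of_comp_sigmaMk {Z : Type*} [MeasurableSpace Z] {F : Vec X → Z}
    (hF : ∀ n : ℕ∞, Measurable fun y : {i : ℕ // (i : ℕ∞) < n} → X => F ⟨n, y⟩) : Measurable F :=
  fun _ hs => MeasurableSpace.measurableSet_iInf.2 fun n => hF n hs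

variable [MeasurableSingletonClass X]

theorem unpack_mk (n : ℕ∞) (y : {i : ℕ // (i : ℕ∞) < n} → X) :
    unpack ⟨n, y⟩ = Config.union fun i => Config.single (y i) := rfl

theorem measurable_union_single {ι : Type*} [Countable ι] :
    Measurable fun y : ι → X => Config.union fun i => Config.single (y i) :=
  Config.measurable_union.comp <| measurable_pi_lambda _ fun i =>
    Config.measurable_single.comp (measurable_pi_apply i)

theorem measurable_unpack : Measurable (unpack (X := X)) := by
  refine measurable_of_comp_sigmaMk fun n => ?_
  simp_rw [unpack_mk]
  exact measurable_union_single

theorem qPoint_mk [Add X] (x : X) (n : ℕ∞) (y : {i : ℕ // (i : ℕ∞) < n} → X) :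
    qPoint (x, ⟨n, y⟩) = Config.union fun i => Config.single (y i + x) := rfl

variable [Add X] [MeasurableAdd₂ X]

theorem measurable_qPoint : Measurable (qPoint (X := X)) := by
  refine measurable_prod_vec fun n => ?_
  simp_rw [qPoint_mk]
  have h : Measurable fun z : X × ({i : ℕ // (i : ℕ∞) < n} → X) => fun i => z.2 i + z.1 :=
    measurable_pi_lambda _ fun i => ((measurable_pi_apply i).comp measurable_snd).add measurable_fst
  exact measurable_union_single.comp h

theorem measurable_qMap : Measurable (qMap (X := X)) :=
  Config.measurable_lift measurable_qPoint

theorem measurable_single_add (x : X) : Measurable fun y : X => Config.single (y + x) :=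
  Config.measurable_single.comp (measurable_add_const x)

theorem measurable_translate (x : X) : Measurable (Config.translate x) := by
  unfold Config.translate
  exact Config.measurable_lift (measurable_single_add x)

theorem translate_unpack (x : X) (v : Vec X) : (unpack v).translate x = qPoint (x, v) := by
  obtain ⟨n, y⟩ := v
  rw [qPoint_mk, unpack_mk, Config.translate]
  exact Config.lift_union_single (measurable_single_add x) y

theorem qMap_attach (γ : Config X) (y : γ.Pt → Vec X) :
    qMap (attach γ y) = Config.union fun p => qPoint (p.loc, y p) := by
  rw [qMap, attach]
  exact Config.lift_union_single measurable_qPoint fun p : γ.Pt => (p.loc, y p)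

theorem map_translate_map_unpack (η : Measure (Vec X)) (x : X) :
    (η.map unpack).map (Config.translate x) = η.map fun v => qPoint (x, v) := by
  rw [Measure.map_map (measurable_translate x) measurable_unpack]
  simp_rw [Function.comp_def, translate_unpack]

/-- Given the centres, the cluster configuration is the image of the marked configuration. -/
theorem clusterLaw_eq_map_liftedLaw (η : Measure (Vec X)) [IsProbabilityMeasure η]
    (γ : Config X) : clusterLaw (η.map unpack) γ = (liftedLaw η γ).map qMap := by
  have h_q : ∀ p : γ.Pt, Measurable fun v => qPoint (p.loc, v) :=
    fun p => measurable_qPoint.comp measurable_prodMk_left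
  rw [clusterLaw, liftedLaw, Measure.map_map measurable_qMap (measurable_attach γ)]
  simp_rw [map_translate_map_unpack]
  have h_pi : Measurable fun (y : γ.Pt → Vec X) p => qPoint (p.loc, y p) :=
    measurable_pi_lambda _ fun p => (h_q p).comp (measurable_pi_apply p)
  -- A product of image measures is the image of the product under the coordinatewise map.
  rw [← Measure.infinitePi_map_pi (fun _ : γ.Pt => η) h_q,
    Measure.map_map Config.measurable_union h_pi]
  simp_rw [Function.comp_def, qMap_attach]

end Vectors

end Cluster

/-! ### Integration over the centres -/

theorem mainTheorem4 {X : Type*} [AddCommGroup X] [TopologicalSpace X] [IsTopologicalAddGroup X]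
    [PolishSpace X] [MeasurableSpace X] [BorelSpace X]
    (μc : MeasureTheory.Measure (Cluster.Config X)) [MeasureTheory.IsProbabilityMeasure μc]
    (μ₀ : MeasureTheory.Measure (Cluster.Config X)) [MeasureTheory.IsProbabilityMeasure μ₀]
    (η : MeasureTheory.Measure (Cluster.Vec X)) [MeasureTheory.IsProbabilityMeasure η]
    (hη : μ₀ = η.map Cluster.unpack) :
    MeasureTheory.IsProbabilityMeasure (Cluster.liftedMeasure μc η) ∧
    MeasureTheory.IsProbabilityMeasure (Cluster.clusterMeasure μc μ₀) ∧
    Measurable (Cluster.unpack (X := X)) ∧ Measurable (Cluster.qMap (X := X)) ∧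
    Cluster.clusterMeasure μc μ₀ = (Cluster.liftedMeasure μc η).map Cluster.qMap := by
  have h_law : Measurable (Cluster.liftedLaw (X := X) η) := Cluster.measurable_map_attach η
  have h_q : Measurable (Cluster.qMap (X := X)) := Cluster.measurable_qMap
  have h_lift : IsProbabilityMeasure (Cluster.liftedMeasure μc η) :=
    isProbabilityMeasure_bind h_law.aemeasurable <| ae_of_all _ fun γ =>
      Measure.isProbabilityMeasure_map (Cluster.measurable_attach γ).aemeasurable
  have h_eq : Cluster.clusterMeasure μc μ₀ = (Cluster.liftedMeasure μc η).map Cluster.qMap := by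
    have h_cond : Cluster.clusterLaw μ₀ = fun γ => (Cluster.liftedLaw η γ).map Cluster.qMap := by
      rw [hη]
      exact funext (Cluster.clusterLaw_eq_map_liftedLaw η)
    -- Writing the push-forward as a `bind` with Dirac masses turns the claim into associativity of
    -- `bind`.
    have h_dirac : Measurable fun γ : Cluster.Config (X × Cluster.Vec X) =>
        Measure.dirac (Cluster.qMap γ) := Measure.measurable_dirac.comp h_q
    rw [Cluster.clusterMeasure, Cluster.liftedMeasure, h_cond, ← Measure.bind_dirac_eq_map _ h_q,
      Measure.bind_bind h_law.aemeasurable h_dirac.aemeasurable]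
    simp_rw [Measure.bind_dirac_eq_map _ h_q]
  refine ⟨h_lift, ?_, Cluster.measurable_unpack, h_q, h_eq⟩
  rw [h_eq]
  exact Measure.isProbabilityMeasure_map h_q.aemeasurable
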